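/- For positive integers $p,q$ let $\mathrm{Kite}_{p,q}$ be the graph obtained from the disjoint union of the complete graph $K_p$ and the path $P_q$ on $q$ vertices by adding one edge between a vertex of $K_p$ and an end vertex of $P_q$. For every integer $p\ge 1$, the graph $\mathrm{Kite}_{p,2}$ is determined by its adjacency spectrum: every finite simple graph whose adjacency matrix has the same eigenvalues, with the same multiplicities, as the adjacency matrix of $\mathrm{Kite}_{p,2}$ is isomorphic to $\mathrm{Kite}_{p,2}$. -/

import Mathlib

universe u v

/-- The kite graph: a complete graph on `Fin p` and a path `0 - 1 - ... - (q - 1)` on `Fin q`,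
joined by one edge between the vertex `0` of the complete graph and the end `0` of the path. -/
def kiteGraph (p q : ℕ) : SimpleGraph (Fin p ⊕ Fin q) where
  Adj
    | .inl i, .inl j => i ≠ j
    | .inr i, .inr j => (SimpleGraph.pathGraph q).Adj i j
    | .inl i, .inr j => i.val = 0 ∧ j.val = 0
    | .inr j, .inl i => i.val = 0 ∧ j.val = 0
  symm := ⟨by
    rintro (i | i) (j | j) h
    · exact Ne.symm h
    · exact h
    · exact h
    · exact SimpleGraph.Adj.symm h⟩
  loopless := ⟨by
    rintro (i | i) h
    · exact h rfl
    · exact SimpleGraph.irrefl _ h⟩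

open Classical in
/-- The adjacency spectrum of a finite graph: the eigenvalues of its real adjacency matrix,
each with its multiplicity as a root of the characteristic polynomial `det (X I - A)`. -/
noncomputable def adjacencySpectrum {V : Type*} [Fintype V] (G : SimpleGraph V) : Multiset ℝ :=
  (G.adjMatrix ℝ).charpoly.roots

/-- Two finite graphs are cospectral if they have the same adjacency spectrum. -/
def Cospectral {V W : Type*} [Fintype V] [Fintype W]
    (G : SimpleGraph V) (H : SimpleGraph W) : Prop :=
  adjacencySpectrum G = adjacencySpectrum H

/-- A finite graph `G` is determined by its adjacency spectrum if every finite graph cospectral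
with `G` (with no other assumption, and on an arbitrary vertex set) is isomorphic to `G`. -/
def IsDeterminedByAdjacencySpectrum {V : Type u} [Fintype V] (G : SimpleGraph V) : Prop :=
  ∀ (W : Type v) [Fintype W] (H : SimpleGraph W), Cospectral H G → Nonempty (H ≃g G)

/-! ### Rank factorisations of real symmetric matrices -/

namespace Matrix
open Polynomial

/-! Add a loop at every vertex, so that closed twins become equal rows. For the kite with `p ≥ 2`,
`A + 1` is a blow-up of the looped path on four vertices, with class sizes `p - 1, 1, 1, 1`. It has
rank 4, and its nonzero eigenvalues have product `-(p - 1)`.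

Let `H` be cospectral, with `n = p + 2` vertices. Its `A + 1` has rank 4 and factors as `Z M Zᵀ`,
with `M` a nonsingular principal 4×4 submatrix and `Z` the identity on the rows of `M`. The product
of its nonzero eigenvalues is `det M * det (Zᵀ Z)`, and integrality of minors bounds this below in
absolute value by `n - 4 + 1 = p - 1`. Equality therefore holds, which makes every row of `Z` a
standard basis vector: `H` is itself a blow-up of a four-vertex graph by cliques
(`exists_eq_submatrix_of_abs_eval_le`). The class sizes have product `p - 1` and sum `p + 2`, so at
most one differs from 1, and the remaining coefficients of the characteristic polynomial identify
the quotient as the path, with the large class at an end (`exists_perm_of_charpoly_eq`). For `p =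
1`, counting edges on three vertices suffices. -/

theorem IsHermitian.rank_eq_of_X_pow_mul_charpoly {n : Type*} [Fintype n] [DecidableEq n]
    {A : Matrix n n ℝ} (hA : A.IsHermitian) {m : ℕ} {q : ℝ[X]} (hq : q.eval 0 ≠ 0)
    (h : X ^ m * A.charpoly = X ^ Fintype.card n * q) : A.rank = m := by
  have hq0 : q ≠ 0 := fun h0 => hq (by rw [h0, eval_zero])
  have h1 := congrArg (fun f : ℝ[X] => f.roots.count 0) h
  rw [roots_mul (mul_ne_zero (pow_ne_zero _ X_ne_zero) A.charpoly_monic.ne_zero),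
    roots_mul (mul_ne_zero (pow_ne_zero _ X_ne_zero) hq0), roots_X_pow, roots_X_pow,
    Multiset.count_add, Multiset.count_add, Multiset.count_nsmul, Multiset.count_nsmul,
    Multiset.count_eq_zero_of_notMem (s := q.roots) (by simpa [hq0] using hq),
    hA.roots_charpoly_eq_eigenvalues, Multiset.count_map] at h1
  rw [hA.rank_eq_card_non_zero_eigs, Fintype.card_subtype]
  have h2 := Finset.card_filter_add_card_filter_not (s := (Finset.univ : Finset n))
    (fun i => hA.eigenvalues i ≠ 0)
  have h3 : (Multiset.filter (fun a => (0 : ℝ) = ((RCLike.ofReal ∘ hA.eigenvalues) a : ℝ))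
      Finset.univ.val).card = (Finset.univ.filter (fun i => ¬ hA.eigenvalues i ≠ 0)).card := by
    rw [← Finset.filter_val, Finset.card_val]
    congr 1
    ext i
    simp [eq_comm]
  rw [h3] at h1
  simp only [Multiset.count_singleton_self, mul_one, Finset.card_univ] at h1 h2
  omega

/-- Expand every row in a basis of the row space chosen among the rows; symmetry then does the same
for the columns. -/
theorem exists_eq_mul_submatrix_mul_transpose {n : Type*} [Fintype n] {A : Matrix n n ℝ}
    (hA : Aᵀ = A) {m : ℕ} (hm : A.rank = m) :
    ∃ (b : Fin m → n) (Z : Matrix n (Fin m) ℝ),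
      A.submatrix id b = Z * A.submatrix b b ∧ A = Z * A.submatrix b b * Zᵀ := by
  obtain ⟨κ, a, ha, hs, hli⟩ := exists_linearIndependent' ℝ A.row
  have : Finite κ := Finite.of_injective a ha
  have := Fintype.ofFinite κ
  have hc : Fintype.card κ = m := by
    rw [← hm, rank_eq_finrank_span_row, ← hs, finrank_span_eq_card hli]
  let e : Fin m ≃ κ := (Fintype.equivFinOfCardEq hc).symm
  have hz : ∀ v, ∃ z : Fin m → ℝ, ∑ j, z j • A.row (a (e j)) = A.row v := by
    intro v
    have hv : A.row v ∈ Submodule.span ℝ (Set.range (A.row ∘ a ∘ e)) := by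
      have : Set.range (A.row ∘ a ∘ e) = Set.range (A.row ∘ a) := by
        rw [← Function.comp_assoc, e.surjective.range_comp]
      rw [this, hs]
      exact Submodule.subset_span ⟨v, rfl⟩
    exact (Submodule.mem_span_range_iff_exists_fun ℝ).1 hv
  choose z hz using hz
  refine ⟨a ∘ e, Matrix.of z, ?_⟩
  have h1 : A = Matrix.of z * A.submatrix (a ∘ e) id := by
    ext v w
    have := congrFun (hz v) w
    simpa [Matrix.mul_apply] using this.symm
  have h2 : A.submatrix id (a ∘ e) = Matrix.of z * A.submatrix (a ∘ e) (a ∘ e) := by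
    conv_lhs => rw [h1]
    rfl
  have h3 : A.submatrix id (a ∘ e) = (A.submatrix (a ∘ e) id)ᵀ := by
    rw [transpose_submatrix, hA]
  refine ⟨h2, ?_⟩
  calc A = Aᵀ := hA.symm
    _ = (A.submatrix (a ∘ e) id)ᵀ * (Matrix.of z)ᵀ := by
      conv_lhs => rw [h1]
      rw [transpose_mul]
    _ = _ := by rw [← h3, h2]

/-- With eigenvalues `λᵢ ≥ 0`, expanding `∏ (1 + λᵢ)` gives `1 + ∑ λᵢ` plus nonnegative terms. -/
theorem PosSemidef.one_add_trace_le_det_one_add {n : Type*} [Fintype n] [DecidableEq n]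
    {P : Matrix n n ℝ} (hP : P.PosSemidef) : 1 + P.trace ≤ (1 + P).det := by
  have hd : (1 + P).det = ∏ i, (1 + hP.isHermitian.eigenvalues i) := by
    have h := congrArg (Polynomial.eval (-1)) hP.isHermitian.charpoly_eq
    rw [eval_charpoly, eval_prod] at h
    have h' : (scalar n (-1 : ℝ)) - P = -(1 + P) := by
      rw [map_neg, map_one, neg_add, sub_eq_add_neg]
    rw [h', det_neg] at h
    have h2 : ∀ i, eval (-1 : ℝ) (X - C ((hP.isHermitian.eigenvalues i : ℝ))) =
        (-1) * (1 + hP.isHermitian.eigenvalues i) := by intro i; simp; ring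
    simp only [RCLike.ofReal_real_eq_id, id_eq, h2, Finset.prod_mul_distrib, Finset.prod_const,
      Finset.card_univ] at h
    exact mul_left_cancel₀ (pow_ne_zero _ (by norm_num)) h
  rw [hd, hP.isHermitian.trace_eq_sum_eigenvalues]
  have key : ∀ s : Finset n, 1 + ∑ i ∈ s, hP.isHermitian.eigenvalues i ≤
      ∏ i ∈ s, (1 + hP.isHermitian.eigenvalues i) := by
    intro s
    induction s using Finset.induction_on with
    | empty => simp
    | insert i s hi ih =>
      rw [Finset.sum_insert hi, Finset.prod_insert hi]
      have h0 := hP.eigenvalues_nonneg i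
      have h1 : 0 ≤ ∑ i ∈ s, hP.isHermitian.eigenvalues i :=
        Finset.sum_nonneg fun j _ => hP.eigenvalues_nonneg j
      nlinarith
  simpa using key Finset.univ

theorem X_pow_mul_charpoly_conj {n m : Type*} [Fintype n] [DecidableEq n] [Fintype m]
    [DecidableEq m] (Z : Matrix n m ℝ) (M : Matrix m m ℝ) :
    X ^ Fintype.card m * (Z * M * Zᵀ).charpoly =
      X ^ Fintype.card n * (M * (Zᵀ * Z)).charpoly := by
  rw [Matrix.mul_assoc, charpoly_mul_comm', Matrix.mul_assoc]

theorem exists_int_det_eq {m : Type*} [Fintype m] [DecidableEq m] {M : Matrix m m ℝ}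
    (hM : ∀ i j, ∃ z : ℤ, M i j = z) : ∃ z : ℤ, M.det = z := by
  choose z hz using hM
  refine ⟨(Matrix.of z).det, ?_⟩
  have h : M = (Int.castRingHom ℝ).mapMatrix (Matrix.of z) := by
    ext i j
    simp [hz]
  rw [h, ← RingHom.map_det]
  rfl

theorem det_one_updateRow {m : Type*} [Fintype m] [DecidableEq m] (i : m) (y : m → ℝ) :
    ((1 : Matrix m m ℝ).updateRow i y).det = y i := by
  rw [← det_transpose, ← updateCol_transpose, transpose_one, ← cramer_apply, cramer_one]
  rfl

theorem eq_one_add_of_submatrix_eq_one {n m : Type*} [Fintype n] [Fintype m] [DecidableEq m]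
    {b : m → n} (hb : Function.Injective b) {Z : Matrix n m ℝ} (hZ : Z.submatrix b id = 1)
    [DecidablePred (· ∈ Set.range b)] :
    Zᵀ * Z = 1 + (Matrix.of fun v i => if v ∈ Set.range b then 0 else Z v i)ᵀ *
      (Matrix.of fun v i => if v ∈ Set.range b then 0 else Z v i) := by
  classical
  have hZb : ∀ i j, Z (b i) j = (1 : Matrix m m ℝ) i j := fun i j => by rw [← hZ]; rfl
  ext i j
  simp only [mul_apply, transpose_apply, add_apply, of_apply]
  rw [← Finset.sum_filter_add_sum_filter_not Finset.univ (· ∈ Set.range b)]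
  congr 1
  · have h : Finset.univ.filter (· ∈ Set.range b) = Finset.univ.image b := by ext; simp
    rw [h, Finset.sum_image hb.injOn]
    simp [hZb, one_apply, eq_comm]
  · rw [Finset.sum_filter]
    refine Finset.sum_congr rfl fun v _ => ?_
    by_cases hv : v ∈ Set.range b <;> simp only [hv, not_true_eq_false, not_false_eq_true,
      if_true, if_false, mul_zero]

/-- Makes `det M * Z v i ^ 2` a minor of `A`, hence an integer when `A` has integer entries. -/
theorem det_submatrix_update {n m : Type*} [Fintype m] [DecidableEq m]
    {A : Matrix n n ℝ} {b : m → n} {Z : Matrix n m ℝ} {M : Matrix m m ℝ}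
    (hA : A = Z * M * Zᵀ) (hZ : Z.submatrix b id = 1) (i : m) (v : n) :
    (A.submatrix (Function.update b i v) (Function.update b i v)).det = Z v i ^ 2 * M.det := by
  have h : Z.submatrix (Function.update b i v) id = (1 : Matrix m m ℝ).updateRow i (Z v) := by
    ext k j
    by_cases hk : k = i
    · subst hk; simp
    · simp [hk, ← hZ]
  have h2 : A.submatrix (Function.update b i v) (Function.update b i v) =
      Z.submatrix (Function.update b i v) id * M * (Z.submatrix (Function.update b i v) id)ᵀ := by
    rw [hA]
    rfl
  rw [h2, det_mul, det_mul, det_transpose, h, det_one_updateRow]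
  ring

/-! ### Rigidity when the product of nonzero eigenvalues is small -/

/-- Each row of `Z` outside the basis adds at least 1 to `|det M| * (1 + tr (Yᵀ Y))`, where `Y` is
`Z` with its basis rows zeroed. Thus `|q(0)| ≥ 1 + (n - m)`, and the assumed bound forces equality
throughout. -/
theorem exists_eq_submatrix_of_abs_eval_le {n : Type*} [Fintype n] [DecidableEq n]
    {A : Matrix n n ℝ} (hA : Aᵀ = A) (h01 : ∀ u v, A u v = 0 ∨ A u v = 1) (h1 : ∀ u, A u u = 1)
    {m : ℕ} {q : ℝ[X]} (hq : q.eval 0 ≠ 0)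
    (h : X ^ m * A.charpoly = X ^ Fintype.card n * q)
    (hle : |q.eval 0| ≤ Fintype.card n - m + 1) :
    ∃ (b : Fin m → n) (c : n → Fin m), |(A.submatrix b b).det| = 1 ∧ (∀ i, c (b i) = i) ∧
      ∀ u v, A u v = A (b (c u)) (b (c v)) := by
  classical
  have hH : A.IsHermitian := by rw [IsHermitian, conjTranspose_eq_transpose_of_trivial, hA]
  obtain ⟨b, Z, hZM, hAZ⟩ :=
    exists_eq_mul_submatrix_mul_transpose hA (hH.rank_eq_of_X_pow_mul_charpoly hq h)
  set M := A.submatrix b b with hM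
  have hint : ∀ u v, ∃ z : ℤ, A u v = z := fun u v => by
    rcases h01 u v with h | h
    · exact ⟨0, by simp [h]⟩
    · exact ⟨1, by simp [h]⟩
  have hq' : q = (M * (Zᵀ * Z)).charpoly := by
    have h' := X_pow_mul_charpoly_conj Z M
    rw [← hAZ, Fintype.card_fin, h] at h'
    exact mul_left_cancel₀ (pow_ne_zero _ X_ne_zero) h'
  have hqd : |q.eval 0| = |M.det| * |(Zᵀ * Z).det| := by
    rw [hq', eval_charpoly, map_zero, zero_sub, det_neg, det_mul, abs_mul, abs_pow, abs_neg,
      abs_one, one_pow, one_mul, abs_mul]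
  have hM0 : M.det ≠ 0 := by
    intro h0
    rw [h0, abs_zero, zero_mul, abs_eq_zero] at hqd
    exact hq hqd
  have hZ : Z.submatrix b id = 1 := by
    have h2 : Z.submatrix b id * M = 1 * M := by
      rw [Matrix.one_mul]
      exact (congrArg (fun B => B.submatrix b id) hZM).symm
    exact ((isUnit_iff_isUnit_det M).2 hM0.isUnit).mul_right_cancel h2
  have hb : Function.Injective b := by
    intro i j hij
    by_contra hne
    exact hM0 (det_zero_of_row_eq hne (by ext k; simp [hM, hij]))
  have hcard : (Finset.univ.filter (· ∉ Set.range b)).card + m = Fintype.card n := by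
    have h2 : (Finset.univ.filter (· ∈ Set.range b)).card = m := by
      have : Finset.univ.filter (· ∈ Set.range b) = Finset.univ.image b := by ext; simp
      rw [this, Finset.card_image_of_injective _ hb, Finset.card_univ, Fintype.card_fin]
    have h3 := Finset.card_filter_add_card_filter_not (s := (Finset.univ : Finset n))
      (· ∈ Set.range b)
    rw [h2, Finset.card_univ] at h3
    omega
  have hAM : ∀ v i, A v (b i) = (Z v ᵥ* M) i := fun v i => congrFun (congrFun hZM v) i
  -- A zero row of `Z` would contradict the unit diagonal of `A`.
  have hZ0 : ∀ v, ∃ i, Z v i ≠ 0 := by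
    intro v
    by_contra! h0
    have := h1 v
    rw [hAZ, mul_apply] at this
    simp [h0] at this
  -- the minors with one row of the basis exchanged are integers
  have hsq : ∀ v i, ∃ k : ℕ, |M.det| * Z v i ^ 2 = k := by
    intro v i
    obtain ⟨z, hz⟩ := exists_int_det_eq (M := A.submatrix (Function.update b i v)
      (Function.update b i v)) fun _ _ => hint _ _
    rw [det_submatrix_update hAZ hZ] at hz
    refine ⟨z.natAbs, ?_⟩
    rw [Nat.cast_natAbs, Int.cast_abs, ← hz, abs_mul, abs_of_nonneg (sq_nonneg (Z v i)), mul_comm]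
  have hD : 1 ≤ |M.det| := by
    obtain ⟨z, hz⟩ := exists_int_det_eq (M := M) fun _ _ => hint _ _
    rw [hz] at hM0 ⊢
    exact_mod_cast Int.one_le_abs (by exact_mod_cast hM0)
  have hS : ∀ v, 1 ≤ |M.det| * ∑ i, Z v i ^ 2 := by
    intro v
    obtain ⟨i, hi⟩ := hZ0 v
    obtain ⟨k, hk⟩ := hsq v i
    have h2 : 0 < |M.det| * Z v i ^ 2 := by positivity
    have h3 : (1 : ℝ) ≤ k := by
      rw [hk] at h2
      exact_mod_cast h2
    calc (1 : ℝ) ≤ |M.det| * Z v i ^ 2 := by rw [hk]; exact h3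
      _ ≤ _ := by
        gcongr
        exact Finset.single_le_sum (f := fun i => Z v i ^ 2) (fun _ _ => sq_nonneg _)
          (Finset.mem_univ i)
  have hsum : |M.det| + ∑ v with v ∉ Set.range b, |M.det| * ∑ i, Z v i ^ 2 ≤
      1 + ∑ v with v ∉ Set.range b, (1 : ℝ) := by
    set Y : Matrix n (Fin m) ℝ := Matrix.of fun v i => if v ∈ Set.range b then 0 else Z v i
      with hY
    have hP : (Yᵀ * Y).PosSemidef := by
      simpa [conjTranspose_eq_transpose_of_trivial] using posSemidef_conjTranspose_mul_self Y
    have h2 := hP.one_add_trace_le_det_one_add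
    rw [hY, ← eq_one_add_of_submatrix_eq_one hb hZ, ← hY] at h2
    have h3 : (Yᵀ * Y).trace = ∑ v with v ∉ Set.range b, ∑ i, Z v i ^ 2 := by
      rw [trace_mul_comm, trace, Finset.sum_filter]
      refine Finset.sum_congr rfl fun v _ => ?_
      by_cases hv : v ∈ Set.range b <;> simp only [diag_apply, mul_apply, transpose_apply, hY,
        of_apply, hv, not_true_eq_false, not_false_eq_true, if_true, if_false, mul_zero,
        Finset.sum_const_zero, sq]
    rw [h3] at h2
    have h4 : |M.det| * (1 + ∑ v with v ∉ Set.range b, ∑ i, Z v i ^ 2) ≤ |q.eval 0| := by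
      rw [hqd]
      gcongr
      exact h2.trans (le_abs_self _)
    rw [mul_add, mul_one, Finset.mul_sum] at h4
    refine h4.trans (hle.trans (le_of_eq ?_))
    rw [Finset.sum_const, nsmul_eq_mul, mul_one, ← hcard]
    push_cast
    ring
  have hD1 : |M.det| = 1 := by
    refine le_antisymm ?_ hD
    have := Finset.sum_le_sum (s := Finset.univ.filter (· ∉ Set.range b)) fun v _ => hS v
    linarith
  have hS1 : ∀ v, ∑ i, Z v i ^ 2 = 1 := by
    intro v
    by_cases hv : v ∈ Set.range b
    · obtain ⟨i, rfl⟩ := hv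
      have : ∀ j, Z (b i) j = (1 : Matrix (Fin m) (Fin m) ℝ) i j := fun j => by rw [← hZ]; rfl
      simp [this, one_apply]
    · simp only [hD1, one_mul] at hsum hS
      refine le_antisymm ?_ (hS v)
      by_contra! hlt
      have := Finset.sum_lt_sum (s := Finset.univ.filter (· ∉ Set.range b)) (fun v _ => hS v)
        ⟨v, by simpa using hv, hlt⟩
      linarith
  -- The squares `Z v i ^ 2` are now integers with sum 1, so the row is `± eᵢ`; the sign is positive
  -- because `A v (b i) = Z v i` is 0 or 1.
  have hcls : ∀ v, ∃ i, ∀ j, Z v j = (1 : Matrix (Fin m) (Fin m) ℝ) i j := by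
    intro v
    obtain ⟨i, hi⟩ := hZ0 v
    obtain ⟨k, hk⟩ := hsq v i
    rw [hD1, one_mul] at hk
    have hsplit := Finset.add_sum_erase Finset.univ (fun j => Z v j ^ 2) (Finset.mem_univ i)
    simp only [hS1] at hsplit
    have hnn : 0 ≤ ∑ j ∈ Finset.univ.erase i, Z v j ^ 2 :=
      Finset.sum_nonneg fun _ _ => sq_nonneg _
    have hk1 : (1 : ℝ) ≤ k := by
      have : 0 < Z v i ^ 2 := by positivity
      rw [hk] at this
      exact_mod_cast this
    have hrest : ∑ j ∈ Finset.univ.erase i, Z v j ^ 2 = 0 := by linarith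
    have hother : ∀ j, j ≠ i → Z v j = 0 := fun j hj => by
      have := (Finset.sum_eq_zero_iff_of_nonneg fun _ _ => sq_nonneg _).1 hrest j
        (by simp [hj])
      simpa using this
    have hone : Z v i = 1 := by
      have h2 : A v (b i) = Z v i := by
        rw [hAM, vecMul, dotProduct, Finset.sum_eq_single i]
        · simp [hM, h1]
        · intro j _ hj
          simp [hother j hj]
        · simp
      have h3 : Z v i ^ 2 = 1 := by linarith
      rcases h01 v (b i) with h4 | h4 <;> rw [h2] at h4
      · simp [h4] at h3
      · exact h4
    refine ⟨i, fun j => ?_⟩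
    by_cases hj : j = i
    · subst hj; simp [hone]
    · simp [hother j hj, one_apply_ne' hj]
  choose c hc using hcls
  have hcol : ∀ u i, A u (b i) = A (b (c u)) (b i) := by
    intro u i
    rw [hAM, vecMul, dotProduct]
    simp [hc, one_apply, hM]
  have hsymm : ∀ u v, A u v = A v u := fun u v => congrFun (congrFun hA.symm u) v
  refine ⟨b, c, hD1, fun i => ?_, fun u v => ?_⟩
  · by_contra hne
    have h2 : Z (b i) i = (1 : Matrix (Fin m) (Fin m) ℝ) i i := by rw [← hZ]; rfl
    rw [hc, one_apply_ne hne, one_apply_eq] at h2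
    exact zero_ne_one h2
  · have h2 : A u v = ((Z * M) * Zᵀ) u v := by rw [← hAZ]
    rw [h2, ← hZM, mul_apply]
    simp only [submatrix_apply, id_eq, transpose_apply, hc, one_apply, mul_ite, mul_one, mul_zero,
      Finset.sum_ite_eq, Finset.mem_univ, if_true]
    exact hcol u _

end Matrix

/-! ### Blow-ups and looped adjacency matrices -/

open Polynomial Matrix

/-- Take for `Z` the indicator matrix of the classes: `Zᵀ * Z` is the diagonal matrix of class
sizes. -/
theorem Matrix.X_pow_mul_charpoly_of_fibers {n m : Type*} [Fintype n] [DecidableEq n] [Fintype m]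
    [DecidableEq m] {A : Matrix n n ℝ} {M : Matrix m m ℝ} {c : n → m}
    (h : ∀ u v, A u v = M (c u) (c v)) :
    X ^ Fintype.card m * A.charpoly = X ^ Fintype.card n *
      (M * diagonal fun i => (Fintype.card {v // c v = i} : ℝ)).charpoly := by
  have hA : A = (Matrix.of fun v i => if c v = i then (1 : ℝ) else 0) * M *
      (Matrix.of fun v i => if c v = i then (1 : ℝ) else 0)ᵀ := by
    ext u v
    simp [mul_apply, h]
  have hD : (Matrix.of fun v i => if c v = i then (1 : ℝ) else 0)ᵀ *
      (Matrix.of fun v i => if c v = i then (1 : ℝ) else 0) =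
      diagonal fun i => (Fintype.card {v // c v = i} : ℝ) := by
    ext i j
    by_cases hij : i = j
    · subst hij
      simp [mul_apply, Fintype.card_subtype, ← ite_and]
    · rw [diagonal_apply_ne _ hij, mul_apply]
      refine Finset.sum_eq_zero fun v _ => ?_
      by_cases hv : c v = i <;> simp [hv, hij]
  rw [← hD, ← X_pow_mul_charpoly_conj, ← hA]

namespace SimpleGraph

open Classical in
/-- The adjacency matrix of a graph with a loop added at each vertex. -/
noncomputable def loopAdjMatrix {V : Type*} (G : SimpleGraph V) : Matrix V V ℝ :=
  G.adjMatrix ℝ + 1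

theorem loopAdjMatrix_apply_self {V : Type*} (G : SimpleGraph V) (u : V) :
    G.loopAdjMatrix u u = 1 := by
  simp [loopAdjMatrix]

theorem loopAdjMatrix_apply_of_ne {V : Type*} (G : SimpleGraph V) {u v : V} (h : u ≠ v)
    [Decidable (G.Adj u v)] : G.loopAdjMatrix u v = if G.Adj u v then 1 else 0 := by
  classical
  rw [loopAdjMatrix, Matrix.add_apply, one_apply_ne h, add_zero, adjMatrix_apply]
  congr

theorem loopAdjMatrix_eq_zero_or_one {V : Type*} (G : SimpleGraph V) (u v : V) :
    G.loopAdjMatrix u v = 0 ∨ G.loopAdjMatrix u v = 1 := by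
  classical
  by_cases h : u = v
  · subst h
    exact .inr (G.loopAdjMatrix_apply_self u)
  · rw [G.loopAdjMatrix_apply_of_ne h]
    by_cases h2 : G.Adj u v <;> simp [h2]

theorem transpose_loopAdjMatrix {V : Type*} (G : SimpleGraph V) :
    G.loopAdjMatrixᵀ = G.loopAdjMatrix := by
  simp [loopAdjMatrix]

theorem loopAdjMatrix_comm {V : Type*} (G : SimpleGraph V) (u v : V) :
    G.loopAdjMatrix u v = G.loopAdjMatrix v u :=
  congrFun (congrFun G.transpose_loopAdjMatrix v) u

theorem adj_iff_loopAdjMatrix {V : Type*} (G : SimpleGraph V) {u v : V} :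
    G.Adj u v ↔ u ≠ v ∧ G.loopAdjMatrix u v = 1 := by
  classical
  by_cases h : u = v
  · subst h; simp
  · rw [G.loopAdjMatrix_apply_of_ne h]
    by_cases h2 : G.Adj u v <;> simp [h, h2]

/-- Two graphs with the same quotient by closed twins and the same class sizes are isomorphic. -/
theorem nonempty_iso_of_fibers {V W ι : Type*} [Fintype V] [Fintype W] [DecidableEq ι]
    {G : SimpleGraph V} {H : SimpleGraph W} {M : Matrix ι ι ℝ} {c : V → ι} {d : W → ι}
    (hG : ∀ u v, G.loopAdjMatrix u v = M (c u) (c v))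
    (hH : ∀ u v, H.loopAdjMatrix u v = M (d u) (d v))
    (hcard : ∀ i, Fintype.card {v // c v = i} = Fintype.card {v // d v = i}) :
    Nonempty (G ≃g H) := by
  let e : V ≃ W := Equiv.ofFiberEquiv (f := c) (g := d) fun i => Fintype.equivOfCardEq (hcard i)
  have he : ∀ v, d (e v) = c v := fun v => Equiv.ofFiberEquiv_map _ v
  refine ⟨⟨e, fun {u v} => ?_⟩⟩
  rw [adj_iff_loopAdjMatrix, adj_iff_loopAdjMatrix, hG, hH, he, he, e.injective.ne_iff]

/-- A real symmetric matrix has a split characteristic polynomial, so the spectrum recovers it; the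
loops only shift the variable by 1. -/
theorem charpoly_loopAdjMatrix {U : Type*} [Fintype U] [DecidableEq U] (K : SimpleGraph U) :
    K.loopAdjMatrix.charpoly =
      ((adjacencySpectrum K).map fun a => X - C a).prod.comp (X + C (-1)) := by
  classical
  have hK : (K.adjMatrix ℝ).IsHermitian := by
    rw [IsHermitian, conjTranspose_eq_transpose_of_trivial, transpose_adjMatrix]
  have h1 : K.loopAdjMatrix = K.adjMatrix ℝ - scalar U (-1) := by
    rw [map_neg, map_one, sub_neg_eq_add, loopAdjMatrix]
    congr!
  have h2 := hK.splits_charpoly.eq_prod_roots_of_monic (Matrix.charpoly_monic _)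
  rw [h1, charpoly_sub_scalar, h2, adjacencySpectrum]
  congr!

theorem charpoly_loopAdjMatrix_eq_of_cospectral {V W : Type*} [Fintype V] [Fintype W]
    [DecidableEq V] [DecidableEq W] {G : SimpleGraph V} {H : SimpleGraph W}
    (h : Cospectral G H) : G.loopAdjMatrix.charpoly = H.loopAdjMatrix.charpoly := by
  rw [charpoly_loopAdjMatrix, charpoly_loopAdjMatrix, h]

end SimpleGraph

/-! ### Quotients on four vertices -/

/-- The entries of the symmetric matrix of order four with unit diagonal and prescribed entries
above it. -/
def unitDiagEntry {R : Type*} [One R] (a b c d e f : R) : Fin 4 → Fin 4 → R :=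
  ![![1, a, b, c], ![a, 1, d, e], ![b, d, 1, f], ![c, e, f, 1]]

theorem det_unitDiagEntry (a b c d e f : ℝ) :
    (Matrix.of (unitDiagEntry a b c d e f)).det =
      1 - a ^ 2 - b ^ 2 - c ^ 2 - d ^ 2 - e ^ 2 - f ^ 2 + 2 * a * b * d + 2 * a * c * e +
      2 * b * c * f + 2 * d * e * f + a ^ 2 * f ^ 2 + b ^ 2 * e ^ 2 + c ^ 2 * d ^ 2
      - 2 * a * b * e * f - 2 * a * c * d * f - 2 * b * c * d * e := by
  simp [det_succ_row_zero, Fin.sum_univ_succ, Fin.succAbove, unitDiagEntry]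
  ring

theorem eval_charpoly_unitDiagEntry_mul_diagonal (a b c d e f k x : ℝ) :
    (Matrix.of (unitDiagEntry a b c d e f) * diagonal ![k, 1, 1, 1]).charpoly.eval x =
      x ^ 4 - (k + 3) * x ^ 3 +
      (k * (3 - a ^ 2 - b ^ 2 - c ^ 2) + (3 - d ^ 2 - e ^ 2 - f ^ 2)) * x ^ 2 -
      (k * (3 + 2 * a * b * d + 2 * a * c * e + 2 * b * c * f
          - 2 * a ^ 2 - 2 * b ^ 2 - 2 * c ^ 2 - d ^ 2 - e ^ 2 - f ^ 2) +
        (1 + 2 * d * e * f - d ^ 2 - e ^ 2 - f ^ 2)) * x +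
      k * (Matrix.of (unitDiagEntry a b c d e f)).det := by
  have h : Matrix.of (unitDiagEntry a b c d e f) * diagonal ![k, 1, 1, 1] =
      !![k, a, b, c; a * k, 1, d, e; b * k, d, 1, f; c * k, e, f, 1] := by
    ext i j
    rw [mul_diagonal]
    fin_cases i <;> fin_cases j <;> simp [unitDiagEntry]
  rw [h, eval_charpoly, det_unitDiagEntry]
  simp [det_succ_row_zero, Fin.sum_univ_succ, Fin.succAbove]
  ring

set_option maxRecDepth 100000 in
/-- A graph on four vertices with three edges such that its adjacency matrix with loops has
determinant `-1` is a path. -/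
theorem exists_perm_unitDiagEntry_eq_path : ∀ a b c d e f : Fin 2,
    a.val + b.val + c.val + d.val + e.val + f.val = 3 →
    (1 - a.val ^ 2 - b.val ^ 2 - c.val ^ 2 - d.val ^ 2 - e.val ^ 2 - f.val ^ 2 +
      2 * a.val * b.val * d.val + 2 * a.val * c.val * e.val + 2 * b.val * c.val * f.val +
      2 * d.val * e.val * f.val + a.val ^ 2 * f.val ^ 2 + b.val ^ 2 * e.val ^ 2 +
      c.val ^ 2 * d.val ^ 2 - 2 * a.val * b.val * e.val * f.val -
      2 * a.val * c.val * d.val * f.val - 2 * b.val * c.val * d.val * e.val : ℤ) = -1 →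
    ∃ σ : Equiv.Perm (Fin 4), (a.val + b.val + c.val = 1 → σ 0 = 0) ∧
      ∀ i j, unitDiagEntry a b c d e f i j = unitDiagEntry (1 : Fin 2) 0 0 1 0 1 (σ i) (σ j) := by
  decide

theorem exists_perm_of_charpoly_eq {a b c d e f : Fin 2} {k : ℕ} (hk : 1 ≤ k)
    (hdet : (Matrix.of (unitDiagEntry (a.val : ℝ) b.val c.val d.val e.val f.val)).det = -1)
    (h : (Matrix.of (unitDiagEntry (a.val : ℝ) b.val c.val d.val e.val f.val) *
        diagonal ![(k : ℝ), 1, 1, 1]).charpoly =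
      (Matrix.of (unitDiagEntry (1 : ℝ) 0 0 1 0 1) * diagonal ![(k : ℝ), 1, 1, 1]).charpoly) :
    ∃ σ : Equiv.Perm (Fin 4), (k = 1 ∨ σ 0 = 0) ∧
      ∀ i j, unitDiagEntry a b c d e f i j = unitDiagEntry (1 : Fin 2) 0 0 1 0 1 (σ i) (σ j) := by
  -- The quartic and cubic coefficients agree automatically and the constant terms by `hdet`, so the
  -- values at `±1` separate the two remaining coefficients.
  have hp := congrArg (eval 1) h
  have hm := congrArg (eval (-1)) h
  rw [eval_charpoly_unitDiagEntry_mul_diagonal, eval_charpoly_unitDiagEntry_mul_diagonal, hdet,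
    det_unitDiagEntry] at hp hm
  rw [det_unitDiagEntry] at hdet
  have h2 : (k * (3 - a.val ^ 2 - b.val ^ 2 - c.val ^ 2) + (3 - d.val ^ 2 - e.val ^ 2 - f.val ^ 2)
      : ℝ) = 2 * k + 1 := by linarith
  have h3 : (k * (3 + 2 * a.val * b.val * d.val + 2 * a.val * c.val * e.val +
        2 * b.val * c.val * f.val - 2 * a.val ^ 2 - 2 * b.val ^ 2 - 2 * c.val ^ 2 - d.val ^ 2 -
        e.val ^ 2 - f.val ^ 2) +
        (1 + 2 * d.val * e.val * f.val - d.val ^ 2 - e.val ^ 2 - f.val ^ 2) : ℝ) = -k - 1 := by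
    linarith
  have hsq : ∀ x : Fin 2, (x.val : ℤ) ^ 2 = x.val := by decide
  have hx : ∀ x : Fin 2, x.val ≤ 1 := by decide
  have hdet' : (1 - a.val ^ 2 - b.val ^ 2 - c.val ^ 2 - d.val ^ 2 - e.val ^ 2 - f.val ^ 2 +
      2 * a.val * b.val * d.val + 2 * a.val * c.val * e.val + 2 * b.val * c.val * f.val +
      2 * d.val * e.val * f.val + a.val ^ 2 * f.val ^ 2 + b.val ^ 2 * e.val ^ 2 +
      c.val ^ 2 * d.val ^ 2 - 2 * a.val * b.val * e.val * f.val -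
      2 * a.val * c.val * d.val * f.val - 2 * b.val * c.val * d.val * e.val : ℤ) = -1 := by
    exact_mod_cast hdet
  have h2' : (k * (3 - a.val ^ 2 - b.val ^ 2 - c.val ^ 2) +
      (3 - d.val ^ 2 - e.val ^ 2 - f.val ^ 2) : ℤ) = 2 * k + 1 := by exact_mod_cast h2
  have h3' : (k * (3 + 2 * a.val * b.val * d.val + 2 * a.val * c.val * e.val +
        2 * b.val * c.val * f.val - 2 * a.val ^ 2 - 2 * b.val ^ 2 - 2 * c.val ^ 2 - d.val ^ 2 -
        e.val ^ 2 - f.val ^ 2) +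
        (1 + 2 * d.val * e.val * f.val - d.val ^ 2 - e.val ^ 2 - f.val ^ 2) : ℤ) = -k - 1 := by
    exact_mod_cast h3
  rw [hsq, hsq, hsq, hsq, hsq, hsq] at h2' h3'
  have key : a.val + b.val + c.val + d.val + e.val + f.val = 3 ∧
      (k = 1 ∨ a.val + b.val + c.val = 1) := by
    have ha := hx a
    have hb := hx b
    have hc := hx c
    have hd := hx d
    have he := hx e
    have hf := hx f
    generalize a.val = a at *
    generalize b.val = b at *
    generalize c.val = c at *
    generalize d.val = d at *
    generalize e.val = e at *
    generalize f.val = f at *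
    clear hdet hdet' hp hm h h2 h3 hsq hx
    -- Once the six edge indicators are fixed, both equations are linear in the unbounded `k`.
    interval_cases a <;> interval_cases b <;> interval_cases c <;> interval_cases d <;>
      interval_cases e <;> interval_cases f <;> norm_num at h2' h3' ⊢ <;> omega
  obtain ⟨σ, h1, hσ⟩ := exists_perm_unitDiagEntry_eq_path a b c d e f key.1 hdet'
  exact ⟨σ, key.2.imp_right h1, hσ⟩

theorem Fintype.sum_card_fibers {n m : Type*} [Fintype n] [Fintype m] [DecidableEq m]
    (c : n → m) : ∑ i, Fintype.card {v // c v = i} = Fintype.card n := by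
  rw [← Fintype.card_sigma]
  exact Fintype.card_congr (Equiv.sigmaFiberEquiv c)

/-! ### The kite as a blow-up of a path -/

/-- The quotient of the kite graph by the clique on the nonzero vertices of the complete graph,
a path on four vertices. -/
def kiteClass (p : ℕ) : Fin p ⊕ Fin 2 → Fin 4
  | .inl i => if i.val = 0 then 1 else 0
  | .inr j => if j = 0 then 2 else 3

theorem loopAdjMatrix_kiteGraph (p : ℕ) (u v : Fin p ⊕ Fin 2) :
    (kiteGraph p 2).loopAdjMatrix u v =
      unitDiagEntry (1 : ℝ) 0 0 1 0 1 (kiteClass p u) (kiteClass p v) := by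
  classical
  by_cases huv : u = v
  · subst huv
    rw [SimpleGraph.loopAdjMatrix_apply_self]
    generalize kiteClass p u = i
    fin_cases i <;> simp [unitDiagEntry]
  · rw [SimpleGraph.loopAdjMatrix_apply_of_ne _ huv]
    rcases u with i | i <;> rcases v with j | j
    · have hij : i ≠ j := fun h => huv (by rw [h])
      have : (kiteGraph p 2).Adj (.inl i) (.inl j) := hij
      rw [if_pos this]
      have hij' : i.val ≠ j.val := fun h => hij (Fin.ext h)
      by_cases hi : i.val = 0 <;> by_cases hj : j.val = 0
      · omega
      all_goals simp [kiteClass, hi, hj, unitDiagEntry]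
    · have h : ∀ j : Fin 2, (kiteGraph p 2).Adj (.inl i) (.inr j) ↔ i.val = 0 ∧ j.val = 0 :=
        fun _ => Iff.rfl
      by_cases hi : i.val = 0 <;> fin_cases j <;> simp [kiteClass, h, hi, unitDiagEntry]
    · have h : ∀ i : Fin 2, (kiteGraph p 2).Adj (.inr i) (.inl j) ↔ j.val = 0 ∧ i.val = 0 :=
        fun _ => Iff.rfl
      by_cases hj : j.val = 0 <;> fin_cases i <;> simp [kiteClass, h, hj, unitDiagEntry]
    · have h : ∀ i j : Fin 2, (kiteGraph p 2).Adj (.inr i) (.inr j) ↔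
          (SimpleGraph.pathGraph 2).Adj i j := fun _ _ => Iff.rfl
      fin_cases i <;> fin_cases j <;>
        simp [kiteClass, h, SimpleGraph.pathGraph_adj, unitDiagEntry] at huv ⊢

theorem card_kiteClass_fiber {p : ℕ} (hp : 1 ≤ p) (i : Fin 4) :
    Fintype.card {v // kiteClass p v = i} = ![p - 1, 1, 1, 1] i := by
  have h1 : Fintype.card {v // kiteClass p v = 1} = 1 := by
    refine Fintype.card_eq_one_iff.2 ⟨⟨.inl ⟨0, hp⟩, rfl⟩, ?_⟩
    rintro ⟨j | j, hj⟩
    · have : j.val = 0 := by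
        by_contra h
        simp [kiteClass, h] at hj
      exact Subtype.ext (congrArg Sum.inl (Fin.ext this))
    · fin_cases j <;> simp [kiteClass] at hj
  have h2 : Fintype.card {v // kiteClass p v = 2} = 1 := by
    refine Fintype.card_eq_one_iff.2 ⟨⟨.inr 0, rfl⟩, ?_⟩
    rintro ⟨j | j, hj⟩
    · by_cases h : j.val = 0 <;> simp [kiteClass, h] at hj
    · fin_cases j
      · rfl
      · simp [kiteClass] at hj
  have h3 : Fintype.card {v // kiteClass p v = 3} = 1 := by
    refine Fintype.card_eq_one_iff.2 ⟨⟨.inr 1, rfl⟩, ?_⟩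
    rintro ⟨j | j, hj⟩
    · by_cases h : j.val = 0 <;> simp [kiteClass, h] at hj
    · fin_cases j
      · simp [kiteClass] at hj
      · rfl
  have h0 := Fintype.sum_card_fibers (kiteClass p)
  rw [Fin.sum_univ_four, h1, h2, h3, Fintype.card_sum, Fintype.card_fin, Fintype.card_fin] at h0
  fin_cases i
  · change Fintype.card {v // kiteClass p v = 0} = p - 1
    omega
  · exact h1
  · exact h2
  · exact h3

theorem X_pow_mul_charpoly_kiteGraph {p : ℕ} (hp : 1 ≤ p) :
    X ^ 4 * (kiteGraph p 2).loopAdjMatrix.charpoly = X ^ (p + 2) *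
      (Matrix.of (unitDiagEntry (1 : ℝ) 0 0 1 0 1) *
        diagonal ![((p - 1 : ℕ) : ℝ), 1, 1, 1]).charpoly := by
  have h := X_pow_mul_charpoly_of_fibers (c := kiteClass p)
    (M := Matrix.of (unitDiagEntry (1 : ℝ) 0 0 1 0 1)) (loopAdjMatrix_kiteGraph p)
  simp only [card_kiteClass_fiber hp, Fintype.card_fin, Fintype.card_sum] at h
  convert h using 5
  ext i
  fin_cases i <;> simp

theorem cast_unitDiagEntry (a b c d e f : Fin 2) (i j : Fin 4) :
    ((unitDiagEntry a b c d e f i j).val : ℝ) =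
      unitDiagEntry (a.val : ℝ) b.val c.val d.val e.val f.val i j := by
  fin_cases i <;> fin_cases j <;> simp [unitDiagEntry]

theorem cast_unitDiagEntry_path (i j : Fin 4) :
    ((unitDiagEntry (1 : Fin 2) 0 0 1 0 1 i j).val : ℝ) = unitDiagEntry (1 : ℝ) 0 0 1 0 1 i j := by
  rw [cast_unitDiagEntry]
  simp

theorem exists_eq_unitDiagEntry {M : Matrix (Fin 4) (Fin 4) ℝ} (hs : ∀ i j, M i j = M j i)
    (h1 : ∀ i, M i i = 1) (h01 : ∀ i j, M i j = 0 ∨ M i j = 1) :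
    ∃ a b c d e f : Fin 2,
      M = Matrix.of (unitDiagEntry (a.val : ℝ) b.val c.val d.val e.val f.val) := by
  have h : ∀ i j, ∃ x : Fin 2, M i j = x.val := fun i j => by
    rcases h01 i j with h | h
    · exact ⟨0, by simp [h]⟩
    · exact ⟨1, by simp [h]⟩
  choose x hx using h
  refine ⟨x 0 1, x 0 2, x 0 3, x 1 2, x 1 3, x 2 3, ?_⟩
  ext i j
  fin_cases i <;> fin_cases j <;> simp [unitDiagEntry, h1, ← hx, hs 1 0, hs 2 0, hs 3 0, hs 2 1,
    hs 3 1, hs 3 2]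

/-! ### Recovering the kite from its spectrum -/

/-- Positive integers with product three less than their sum are all `1` up to one exception. -/
theorem exists_forall_ne_eq_one {n : Fin 4 → ℕ} (hn : ∀ i, 1 ≤ n i)
    (h : ∏ i, n i + 3 = ∑ i, n i) : ∃ i, ∀ j, j ≠ i → n j = 1 := by
  have h2 : ∀ i j, i ≠ j → n i = 1 ∨ n j = 1 := by
    choose a ha using fun i => Nat.exists_eq_add_of_le (hn i)
    rw [Fin.prod_univ_four, Fin.sum_univ_four, ha, ha, ha, ha] at h
    -- Writing `n i = 1 + a i`, the hypothesis says that the elementary symmetric functions of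
    -- degrees 2, 3 and 4 in the `a i` sum to zero.
    have h0 : a 0 * a 1 + a 0 * a 2 + a 0 * a 3 + a 1 * a 2 + a 1 * a 3 + a 2 * a 3 = 0 := by
      have : 0 ≤ a 0 * a 1 * a 2 + a 0 * a 1 * a 3 + a 0 * a 2 * a 3 + a 1 * a 2 * a 3 +
        a 0 * a 1 * a 2 * a 3 := Nat.zero_le _
      nlinarith
    simp only [Nat.add_eq_zero_iff, mul_eq_zero] at h0
    intro i j hij
    rw [ha, ha]
    fin_cases i <;> fin_cases j <;> simp at hij ⊢ <;> tauto
  by_contra! hc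
  obtain ⟨j, hj, hj'⟩ := hc 0
  obtain ⟨k, hk, hk'⟩ := hc j
  rcases h2 j k hk.symm with h | h
  · exact hj' h
  · exact hk' h

theorem nonempty_iso_kiteGraph_of_two_le {W : Type v} [Fintype W] {H : SimpleGraph W} {p : ℕ}
    (hp : 2 ≤ p) (hcard : Fintype.card W = p + 2) {q : ℝ[X]}
    (hq : q = (Matrix.of (unitDiagEntry (1 : ℝ) 0 0 1 0 1) *
        diagonal ![((p - 1 : ℕ) : ℝ), 1, 1, 1]).charpoly)
    (hH : open Classical in X ^ 4 * H.loopAdjMatrix.charpoly = X ^ (p + 2) * q) :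
    Nonempty (H ≃g kiteGraph p 2) := by
  classical
  obtain ⟨k, rfl⟩ : ∃ k, p = k + 1 := ⟨p - 1, by omega⟩
  rw [Nat.add_sub_cancel] at hq
  have hk : 1 ≤ k := by omega
  have hk' : (1 : ℝ) ≤ k := by exact_mod_cast hk
  have hq0 : q.eval 0 = -k := by
    rw [hq, eval_charpoly_unitDiagEntry_mul_diagonal, det_unitDiagEntry]
    ring
  -- The bound is tight here: `|q(0)| = k = (k + 3) - 4 + 1`.
  obtain ⟨b, c, hdet, hcb, hA⟩ := exists_eq_submatrix_of_abs_eval_le (m := 4) (q := q)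
    H.transpose_loopAdjMatrix H.loopAdjMatrix_eq_zero_or_one H.loopAdjMatrix_apply_self
    (by rw [hq0]; linarith) (by rw [hcard]; exact hH)
    (by rw [hq0, abs_neg, hcard, abs_of_nonneg (by linarith)]; push_cast; linarith)
  have hqc : ∀ (M : Matrix (Fin 4) (Fin 4) ℝ) (c : W → Fin 4),
      (∀ u v, H.loopAdjMatrix u v = M (c u) (c v)) →
      q = (M * diagonal fun i => (Fintype.card {v // c v = i} : ℝ)).charpoly := by
    intro M c hMc
    have h := X_pow_mul_charpoly_of_fibers hMc
    rw [Fintype.card_fin, hcard, hH] at h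
    exact mul_left_cancel₀ (pow_ne_zero _ X_ne_zero) h
  set M := H.loopAdjMatrix.submatrix b b with hM
  have hprod : M.det * ((∏ i, Fintype.card {v // c v = i} : ℕ) : ℝ) = -k := by
    rw [← hq0, hqc M c hA, eval_charpoly, map_zero, zero_sub, det_neg, det_mul, det_diagonal,
      Fintype.card_fin, (by norm_num : (-1 : ℝ) ^ 4 = 1), one_mul, Nat.cast_prod]
  have hpos : ∀ i, 1 ≤ Fintype.card {v // c v = i} := fun i =>
    Fintype.card_pos_iff.2 ⟨⟨b i, hcb i⟩⟩
  have hdet1 : M.det = -1 := by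
    rcases (abs_eq zero_le_one).1 hdet with h | h
    · rw [h, one_mul] at hprod
      have : (0 : ℝ) ≤ ((∏ i, Fintype.card {v // c v = i} : ℕ) : ℝ) := Nat.cast_nonneg _
      linarith
    · exact h
  have hprod' : ∏ i, Fintype.card {v // c v = i} = k := by
    rw [hdet1] at hprod
    have : ((∏ i, Fintype.card {v // c v = i} : ℕ) : ℝ) = k := by linarith
    exact_mod_cast this
  obtain ⟨i₀, hi₀⟩ := exists_forall_ne_eq_one hpos (by
    rw [Fintype.sum_card_fibers, hprod', hcard])
  have hi₀k : Fintype.card {v // c v = i₀} = k := by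
    rw [← hprod', Finset.prod_eq_single i₀ (fun j _ hj => hi₀ j hj) (by simp)]
  -- Moves the class of size `k` to index 0, the place of the large class of the kite.
  let τ : Equiv.Perm (Fin 4) := Equiv.swap 0 i₀
  have hfib : ∀ (σ : Equiv.Perm (Fin 4)) i,
      Fintype.card {v // σ (τ (c v)) = i} = if σ.symm i = 0 then k else 1 := by
    intro σ i
    have h : Fintype.card {v // σ (τ (c v)) = i} = Fintype.card {v // c v = τ (σ.symm i)} :=
      Fintype.card_congr (Equiv.subtypeEquivRight fun v => by
        rw [← Equiv.eq_symm_apply, ← Equiv.eq_symm_apply]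
        simp [τ])
    rw [h]
    by_cases hi : σ.symm i = 0
    · rw [if_pos hi, hi, Equiv.swap_apply_left, hi₀k]
    · rw [if_neg hi, hi₀]
      intro h2
      exact hi (τ.injective (by rw [h2, Equiv.swap_apply_left]))
  have hA' : ∀ u v, H.loopAdjMatrix u v = M.submatrix τ τ (τ (c u)) (τ (c v)) := by
    intro u v
    rw [hA, submatrix_apply, Equiv.swap_apply_self, Equiv.swap_apply_self]
    rfl
  obtain ⟨x₀, x₁, x₂, x₃, x₄, x₅, hx⟩ := exists_eq_unitDiagEntry (M := M.submatrix τ τ)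
    (fun _ _ => H.loopAdjMatrix_comm _ _) (fun _ => H.loopAdjMatrix_apply_self _)
    (fun _ _ => H.loopAdjMatrix_eq_zero_or_one _ _)
  have hdet2 : (M.submatrix τ τ).det = -1 := by rw [det_submatrix_equiv_self, hdet1]
  have hq2 := hqc _ _ hA'
  have hdiag : (fun i => (Fintype.card {v // τ (c v) = i} : ℝ)) = ![(k : ℝ), 1, 1, 1] := by
    ext i
    have h : Fintype.card {v // τ (c v) = i} = if i = 0 then k else 1 := hfib (Equiv.refl _) i
    rw [h]
    fin_cases i <;> simp
  rw [hdiag, hx, hq] at hq2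
  rw [hx] at hdet2
  obtain ⟨σ, hσ0, hσ⟩ := exists_perm_of_charpoly_eq hk hdet2 hq2.symm
  refine SimpleGraph.nonempty_iso_of_fibers (c := fun v => σ (τ (c v))) (fun u v => ?_)
    (loopAdjMatrix_kiteGraph _) fun i => ?_
  · rw [hA', hx, of_apply, ← cast_unitDiagEntry, hσ, cast_unitDiagEntry_path]
  · rw [hfib, card_kiteClass_fiber (by omega), Nat.add_sub_cancel]
    -- If `k = 1`, all classes are singletons and `σ` need not fix 0.
    rcases hσ0 with h | h
    · subst h
      rw [ite_self]
      fin_cases i <;> rfl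
    · have hi : σ.symm i = 0 ↔ i = 0 := by rw [Equiv.symm_apply_eq, h]
      simp only [hi]
      fin_cases i <;> rfl

theorem eval_charpoly_three_unitDiag (a b d x : ℝ) :
    (!![1, a, b; a, 1, d; b, d, 1] : Matrix (Fin 3) (Fin 3) ℝ).charpoly.eval x =
      (x - 1) ^ 3 - (a ^ 2 + b ^ 2 + d ^ 2) * (x - 1) - 2 * a * b * d := by
  rw [eval_charpoly, det_fin_three]
  simp
  ring

theorem exists_perm_three_unitDiag_eq_path : ∀ a b d : Fin 2,
    a.val + b.val + d.val = 2 →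
    ∃ σ : Equiv.Perm (Fin 3), ∀ i j,
      (![![1, a, b], ![a, 1, d], ![b, d, 1]] : Fin 3 → Fin 3 → Fin 2) i j =
        unitDiagEntry (1 : Fin 2) 0 0 1 0 1 (σ i).succ (σ j).succ := by
  decide

/-- Here the class of size `p - 1` is empty, so `q(0) = 0` and the rank argument does not apply. -/
theorem nonempty_iso_kiteGraph_one_two {W : Type v} [Fintype W] {H : SimpleGraph W}
    (hcard : Fintype.card W = 3)
    (hH : open Classical in X ^ 4 * H.loopAdjMatrix.charpoly = X ^ 3 *
      (Matrix.of (unitDiagEntry (1 : ℝ) 0 0 1 0 1) *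
        diagonal ![(0 : ℝ), 1, 1, 1]).charpoly) :
    Nonempty (H ≃g kiteGraph 1 2) := by
  classical
  let e : W ≃ Fin 3 := Fintype.equivFinOfCardEq hcard
  have h : ∀ i j, ∃ x : Fin 2, H.loopAdjMatrix (e.symm i) (e.symm j) = x.val := fun i j => by
    rcases H.loopAdjMatrix_eq_zero_or_one (e.symm i) (e.symm j) with h | h
    · exact ⟨0, by simp [h]⟩
    · exact ⟨1, by simp [h]⟩
  choose x hx using h
  have hN : reindex e e H.loopAdjMatrix = !![1, ((x 0 1).val : ℝ), (x 0 2).val;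
      (x 0 1).val, 1, (x 1 2).val; (x 0 2).val, (x 1 2).val, 1] := by
    have hs := fun i j => H.loopAdjMatrix_comm (e.symm i) (e.symm j)
    ext i j
    fin_cases i <;> fin_cases j <;>
      simp [← hx, SimpleGraph.loopAdjMatrix_apply_self, hs 1 0, hs 2 0, hs 2 1]
  rw [← charpoly_reindex e, hN] at hH
  -- At 1 only the triangle term of the cubic survives, so it vanishes; the value at -1 then gives
  -- the number of edges.
  have hp := congrArg (eval 1) hH
  have hm := congrArg (eval (-1)) hH
  rw [eval_mul, eval_mul, eval_charpoly_three_unitDiag,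
    eval_charpoly_unitDiagEntry_mul_diagonal] at hp hm
  simp only [eval_pow, eval_X] at hp hm
  have hsum : (((x 0 1).val : ℝ) ^ 2 + (x 0 2).val ^ 2 + (x 1 2).val ^ 2) = 2 := by linarith
  have hsum' : (x 0 1).val + (x 0 2).val + (x 1 2).val = 2 := by
    have hsq : ∀ y : Fin 2, y.val ^ 2 = y.val := by decide
    rw [← hsq (x 0 1), ← hsq (x 0 2), ← hsq (x 1 2)]
    exact_mod_cast hsum
  obtain ⟨σ, hσ⟩ := exists_perm_three_unitDiag_eq_path _ _ _ hsum'
  refine SimpleGraph.nonempty_iso_of_fibers (c := fun v => (σ (e v)).succ) (fun u v => ?_)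
    (loopAdjMatrix_kiteGraph _) fun i => ?_
  · rw [← cast_unitDiagEntry_path, ← hσ]
    have h2 : H.loopAdjMatrix u v = reindex e e H.loopAdjMatrix (e u) (e v) := by simp
    rw [h2, hN]
    generalize e u = i
    generalize e v = j
    fin_cases i <;> fin_cases j <;> simp
  · rw [card_kiteClass_fiber le_rfl]
    refine Fin.cases ?_ (fun j => ?_) i
    · simp [Fin.succ_ne_zero]
    · have : Fintype.card {v // (σ (e v)).succ = j.succ} = 1 :=
        Fintype.card_eq_one_iff.2 ⟨⟨e.symm (σ.symm j), by simp⟩, fun ⟨v, hv⟩ => by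
          simp [← Fin.succ_injective _ hv]⟩
      rw [this]
      fin_cases j <;> rfl

theorem theorem4p2 (p : ℕ) (hp : 1 ≤ p) :
    IsDeterminedByAdjacencySpectrum.{0, v} (kiteGraph p 2) := by
  intro W _ H hH
  classical
  have hχ := SimpleGraph.charpoly_loopAdjMatrix_eq_of_cospectral hH
  have hcard : Fintype.card W = p + 2 := by
    have := congrArg natDegree hχ
    rwa [charpoly_natDegree_eq_dim, charpoly_natDegree_eq_dim, Fintype.card_sum, Fintype.card_fin,
      Fintype.card_fin] at this
  have h := X_pow_mul_charpoly_kiteGraph hp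
  rw [← hχ] at h
  rcases hp.eq_or_lt with rfl | hp2
  · refine nonempty_iso_kiteGraph_one_two hcard ?_
    simpa using h
  · exact nonempty_iso_kiteGraph_of_two_le hp2 hcard rfl h
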